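/- Let $\mu$ be a probability distribution with compact support on the space $\mathbb{R}^{d\times d}$ of real $d\times d$ matrices, let $\mathcal M=\operatorname{supp}\mu$, and let $A$ be a random matrix with law $\mu$. Assume that (a) $\mathcal M$ leaves a proper cone invariant: there is a set $K\subset\mathbb{R}^d$ that is closed under multiplication by nonnegative scalars, topologically closed, convex, has nonempty interior and contains no line ($x,-x\in K$ implies $x=0$), such that $MK\subset K$ for every $M\in\mathcal M$; (b) the singular part $\mu_s$ of $\mu$ with respect to Lebesgue measure on $\mathbb{R}^{d\times d}$ consists of only finitely many (possibly no) point measures: $\mu_s=\sum_{i=1}^N p_i\delta_{M_i}$ with $N\ge 0$, $p_i>0$ and $M_i\in\mathbb{R}^{d\times d}$. Let $\|\cdot\|$ be any norm on $\mathbb{R}^{d\times d}$ and let $$\hat\rho(\mathcal M)=\limsup_{k\to\infty}\ \sup_{A_1,\dots,A_k\in\mathcal M}\|A_k\cdots A_1\|^{1/k}$$ be the joint spectral radius of $\mathcal M$. Then $\hat\rho(\mathcal M)$ is finite and $$\hat\rho(\mathcal M)=\lim_{p\to\infty}\rho\left(E[A^{\otimes p}]\right)^{1/p},$$ where $p$ runs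 over the positive integers, $A^{\otimes p}\in\mathbb{R}^{d^p\times d^p}$ is the $p$-th Kronecker power ($A^{\otimes 1}=A$, $A^{\otimes p}=A^{\otimes (p-1)}\otimes A$) and $\rho$ denotes the spectral radius of a matrix (the largest modulus of its complex eigenvalues). In particular, the limit exists. -/

import Mathlib

open MeasureTheory Filter Topology
open scoped ENNReal Kronecker

section MatrixMeasure

/-- The product (equivalently, Borel) σ-algebra on `ℝ^{d×d}`. -/
instance matrixMeasurableSpace (d : ℕ) : MeasurableSpace (Matrix (Fin d) (Fin d) ℝ) :=
  inferInstanceAs (MeasurableSpace (Fin d → Fin d → ℝ))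

instance matrixBorelSpace (d : ℕ) : BorelSpace (Matrix (Fin d) (Fin d) ℝ) :=
  inferInstanceAs (BorelSpace (Fin d → Fin d → ℝ))

/-- Lebesgue measure on `ℝ^{d×d}`, identified entrywise with the `d²`-fold product of `ℝ`. -/
noncomputable def matrixLebesgue (d : ℕ) : Measure (Matrix (Fin d) (Fin d) ℝ) :=
  (volume : Measure (Fin d → Fin d → ℝ))

end MatrixMeasure

/-- A proper cone in `ℝ^d`: closed under multiplication by nonnegative scalars, topologically
closed, convex, with nonempty interior, and containing no line. -/
structure IsProperCone {d : ℕ} (K : Set (Fin d → ℝ)) : Prop where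
  smul_mem : ∀ c : ℝ, 0 ≤ c → ∀ x ∈ K, c • x ∈ K
  isClosed : IsClosed K
  convex : Convex ℝ K
  solid : (interior K).Nonempty
  pointed : ∀ x : Fin d → ℝ, x ∈ K → -x ∈ K → x = 0

/-- The set `S` of matrices leaves `K` invariant: `M K ⊆ K` for every `M ∈ S`. -/
def LeavesInvariant {d : ℕ} (S : Set (Matrix (Fin d) (Fin d) ℝ)) (K : Set (Fin d → ℝ)) : Prop :=
  ∀ M ∈ S, ∀ x ∈ K, M.mulVec x ∈ K

/-- The singular part of `μ` with respect to Lebesgue measure is a finite (possibly empty) sum of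
positive multiples of point measures. -/
def SingularPartIsFinitelyAtomic {d : ℕ} (μ : Measure (Matrix (Fin d) (Fin d) ℝ)) : Prop :=
  ∃ (N : ℕ) (w : Fin N → ℝ) (M : Fin N → Matrix (Fin d) (Fin d) ℝ),
    (∀ i, 0 < w i) ∧
      μ.singularPart (matrixLebesgue d) = ∑ i, ENNReal.ofReal (w i) • Measure.dirac (M i)

/-- The joint spectral radius of a set `S` of matrices, computed with the norm `ν`:
`limsup_{k → ∞} sup_{A_1, …, A_k ∈ S} ν(A_k ⋯ A_1)^{1/k}`, as an extended nonnegative number.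
`A 0, …, A (k - 1)` play the roles of `A_1, …, A_k`. -/
noncomputable def jointSpectralRadius {d : ℕ} (ν : Seminorm ℝ (Matrix (Fin d) (Fin d) ℝ))
    (S : Set (Matrix (Fin d) (Fin d) ℝ)) : ℝ≥0∞ :=
  limsup (fun k : ℕ =>
    ⨆ (A : Fin k → Matrix (Fin d) (Fin d) ℝ) (_ : ∀ i, A i ∈ S),
      ENNReal.ofReal (ν (List.ofFn fun i : Fin k => A i.rev).prod) ^ (1 / (k : ℝ))) atTop

/-- The Kronecker power `M^{⊗p} ∈ ℝ^{d^p × d^p}`, with `M^{⊗(p+1)} = M^{⊗p} ⊗ M`, rows and columns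
numbered lexicographically as usual for the Kronecker product. The value at `p = 0` is the `1 × 1`
identity matrix, so that `M^{⊗1}` is `M`. -/
noncomputable def kroneckerPow {d : ℕ} (M : Matrix (Fin d) (Fin d) ℝ) :
    (p : ℕ) → Matrix (Fin (d ^ p)) (Fin (d ^ p)) ℝ
  | 0 => 1
  | p + 1 => Matrix.reindex finProdFinEquiv finProdFinEquiv (kroneckerPow M p ⊗ₖ M)

theorem kroneckerPow_one {d : ℕ} (M : Matrix (Fin d) (Fin d) ℝ) :
    kroneckerPow M 1 =
      Matrix.reindex (finCongr (pow_one d).symm) (finCongr (pow_one d).symm) M := by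
  have key : ∀ i : Fin (d ^ 1),
      (finProdFinEquiv.symm i : Fin (d ^ 0) × Fin d).2 = finCongr (pow_one d) i := by
    intro i
    have hi : (i : ℕ) < d := by simpa using i.2
    ext
    change (i : ℕ) % d = i
    exact Nat.mod_eq_of_lt hi
  have h1 : ∀ a b : Fin (d ^ 0), (kroneckerPow M 0) a b = 1 := by
    intro a b
    have hab : a = b := Subsingleton.elim (α := Fin 1) a b
    subst hab
    exact Matrix.one_apply_eq a
  ext i j
  change (kroneckerPow M 0) (finProdFinEquiv.symm i).1 (finProdFinEquiv.symm j).1 *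
    M (finProdFinEquiv.symm i).2 (finProdFinEquiv.symm j).2 = _
  rw [h1, key, key, one_mul]
  rfl

/-- The matrix `E[A^{⊗p}]`, where `A` has law `μ`; expectations are taken entrywise. -/
noncomputable def expectedKroneckerPow {d : ℕ} (μ : Measure (Matrix (Fin d) (Fin d) ℝ)) (p : ℕ) :
    Matrix (Fin (d ^ p)) (Fin (d ^ p)) ℝ :=
  Matrix.of fun i j => ∫ X, kroneckerPow X p i j ∂μ

/-- The spectral radius of a real square matrix: the largest modulus of its complex eigenvalues. -/
noncomputable def matrixSpectralRadius {n : ℕ} (M : Matrix (Fin n) (Fin n) ℝ) : ℝ≥0∞ :=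
  spectralRadius ℂ (M.map (algebraMap ℝ ℂ))

/-! ### Proper cones -/

namespace IsProperCone

variable {d : ℕ} {K : Set (Fin d → ℝ)}

/-! For independent `A_i` of law `μ`, `E[A^{⊗p}]^k` is the expectation of `(A_k ⋯ A_1)^{⊗p}`. If `b`
exceeds the joint spectral radius, long products of length `k` have entries at most `C * b ^ k`, so
this matrix has entries at most `(C * b ^ k) ^ p`, and Gelfand's formula bounds its spectral radius
by `b ^ p` (`matrixSpectralRadius_rpow_le_jointSpectralRadius`).

For the converse, let `ρ(E[A^{⊗p}]) < r ^ p` for arbitrarily large `p`, and let `y` be a functional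
dominating the norm on `K`. The series `Φ(x) = ∑ r^{-pk} E[(y · A_k ⋯ A_1 x)^p]` converges, is
convex, monotone and `p`-homogeneous on `K`, and satisfies `E[Φ(A x)] ≤ r ^ p * Φ(x)`. Hence `v =
Φ^{1/p}` behaves like a norm on `K`, and every set of mass at least `m` contains, for each `x`, some
`A` with `v(A x) ≤ r * m^{-1/p} * v(x)` (`exists_isConeNorm`). The loss `m^{-1/p}` tends to `1`, so
it remains to pass from some `A` to all of them.

If every point of the support is an atom, this is immediate. Otherwise the support meets the
interior of the convex set of matrices preserving `K`: its frontier is Lebesgue-null, so a measure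
living there is purely singular, hence finitely atomic. Matrices near an interior point push `x` so
far into `K` that `y · x` is at most a multiple of `v(x) / v(e)` not depending on `p`, with `e` an
order unit. This makes `v(A x)` vary little with `A`, and small balls replace atoms. -/

theorem zero_mem (hK : IsProperCone K) : (0 : Fin d → ℝ) ∈ K := by
  obtain ⟨x, hx⟩ := hK.solid
  simpa using hK.smul_mem 0 le_rfl x (interior_subset hx)

theorem add_mem (hK : IsProperCone K) {x y : Fin d → ℝ} (hx : x ∈ K) (hy : y ∈ K) :
    x + y ∈ K := by
  have h := hK.smul_mem 2 zero_le_two _ (hK.convex hx hy (a := 1 / 2) (b := 1 / 2)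
    (by norm_num) (by norm_num) (by norm_num))
  simpa [smul_add, smul_smul] using h

/-- A proper cone contains an order unit. -/
theorem exists_order_unit (hK : IsProperCone K) :
    ∃ e ∈ K, ∃ C : ℝ, 0 < C ∧ ∀ z : Fin d → ℝ, (C * ‖z‖) • e + z ∈ K := by
  obtain ⟨e, he⟩ := hK.solid
  obtain ⟨δ, hδ, hball⟩ := Metric.isOpen_iff.1 isOpen_interior e he
  -- Rescaled to length `δ / 2`, the vector `z` stays inside the ball of radius `δ` around `e`;
  -- undoing the scaling multiplies `e` by `2 * ‖z‖ / δ`.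
  refine ⟨e, interior_subset he, 2 / δ, by positivity, fun z => ?_⟩
  rcases eq_or_ne z 0 with rfl | hz
  · simpa using hK.zero_mem
  have hz' : 0 < ‖z‖ := norm_pos_iff.2 hz
  have hmem : e + (δ / (2 * ‖z‖)) • z ∈ K := by
    refine interior_subset (hball ?_)
    rw [mem_ball_iff_norm, add_sub_cancel_left, norm_smul, Real.norm_of_nonneg (by positivity)]
    field_simp
    linarith
  have h := hK.smul_mem (2 / δ * ‖z‖) (by positivity) _ hmem
  rw [smul_add, smul_smul] at h
  convert h using 2
  rw [show 2 / δ * ‖z‖ * (δ / (2 * ‖z‖)) = 1 by field_simp, one_smul]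

/-- Pointedness puts `-x` outside the closed convex cone `K`, and a hyperplane separates the two. -/
theorem exists_functional_pos (hK : IsProperCone K) {x : Fin d → ℝ} (hx : x ∈ K) (hx0 : x ≠ 0) :
    ∃ f : StrongDual ℝ (Fin d → ℝ), (∀ z ∈ K, 0 ≤ f z) ∧ 0 < f x := by
  let C : ProperCone ℝ (Fin d → ℝ) :=
    { carrier := K
      add_mem' := fun ha hb => hK.add_mem ha hb
      zero_mem' := hK.zero_mem
      smul_mem' := fun c _ hz => hK.smul_mem c c.2 _ hz
      isClosed' := hK.isClosed }
  have hnot : -x ∉ C := fun h => hx0 (hK.pointed x hx h)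
  obtain ⟨f, hf, hfx⟩ := C.hyperplane_separation_point hnot
  exact ⟨f, hf, by simpa using hfx⟩

/-- On a proper cone the norm is dominated by a linear functional. -/
theorem exists_norm_le_dotProduct (hK : IsProperCone K) :
    ∃ y : Fin d → ℝ, ∀ x ∈ K, ‖x‖ ≤ y ⬝ᵥ x := by
  have hcomp : IsCompact (K ∩ Metric.sphere 0 1) := (isCompact_sphere 0 1).inter_left hK.isClosed
  obtain ⟨f, hf, hfpos⟩ : ∃ f : StrongDual ℝ (Fin d → ℝ), (∀ z ∈ K, 0 ≤ f z) ∧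
      ∀ z ∈ (K ∩ Metric.sphere 0 1) ∩ K, 0 < f z := by
    -- Functionals that are nonnegative on `K` and positive on two pieces add up to one positive on
    -- the union, so by compactness of the slice a local choice suffices.
    refine hcomp.induction_on
      (p := fun s => ∃ f : StrongDual ℝ (Fin d → ℝ), (∀ z ∈ K, 0 ≤ f z) ∧ ∀ z ∈ s ∩ K, 0 < f z)
      ⟨0, by simp⟩ ?_ ?_ ?_
    · rintro s t hst ⟨f, hf, hft⟩
      exact ⟨f, hf, fun z hz => hft z ⟨hst hz.1, hz.2⟩⟩
    · rintro s t ⟨f, hf, hfs⟩ ⟨g, hg, hgt⟩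
      refine ⟨f + g, fun z hz => add_nonneg (hf z hz) (hg z hz), ?_⟩
      rintro z ⟨hz | hz, hzK⟩
      · exact add_pos_of_pos_of_nonneg (hfs z ⟨hz, hzK⟩) (hg z hzK)
      · exact add_pos_of_nonneg_of_pos (hf z hzK) (hgt z ⟨hz, hzK⟩)
    · rintro x ⟨hxK, hx⟩
      have hx0 : x ≠ 0 := by
        rintro rfl
        simp at hx
      obtain ⟨f, hf, hfx⟩ := hK.exists_functional_pos hxK hx0
      exact ⟨{z | 0 < f z},
        mem_nhdsWithin_of_mem_nhds ((isOpen_lt continuous_const f.continuous).mem_nhds hfx),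
        f, hf, fun z hz => hz.1⟩
  obtain ⟨c, hc, hcf⟩ : ∃ c : ℝ, 0 < c ∧ ∀ z ∈ K ∩ Metric.sphere 0 1, c ≤ f z := by
    rcases (K ∩ Metric.sphere 0 1).eq_empty_or_nonempty with h | h
    · exact ⟨1, one_pos, by simp [h]⟩
    · obtain ⟨z, hz, hmin⟩ := hcomp.exists_isMinOn h f.continuous.continuousOn
      exact ⟨f z, hfpos z ⟨hz, hz.1⟩, fun w hw => hmin hw⟩
  refine ⟨fun i => c⁻¹ * f (Pi.single i 1), fun x hx => ?_⟩
  have hfx : (fun i => c⁻¹ * f (Pi.single i 1)) ⬝ᵥ x = c⁻¹ * f x := by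
    conv_rhs => rw [pi_eq_sum_univ' x, map_sum, Finset.mul_sum]
    refine Finset.sum_congr rfl fun i _ => ?_
    rw [map_smul, smul_eq_mul]
    change c⁻¹ * f (Pi.single i 1) * x i = _
    ring
  rw [hfx]
  rcases eq_or_ne x 0 with rfl | hx0
  · simp
  have hx' : 0 < ‖x‖ := norm_pos_iff.2 hx0
  have h := hcf (‖x‖⁻¹ • x) ⟨hK.smul_mem _ (by positivity) _ hx, by
    simp [norm_smul, hx'.ne']⟩
  rw [map_smul, smul_eq_mul, ← div_eq_inv_mul, le_div_iff₀ hx'] at h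
  rw [← div_eq_inv_mul, le_div_iff₀ hc]
  linarith

end IsProperCone

/-! ### Norms of matrices -/

section MatrixNorms

variable {d : ℕ}

/-- Expansion in matrix units; the `+ 1` keeps the constant positive when `d = 0` or `ν = 0`. -/
theorem Seminorm.exists_le_of_abs_entry_le (ν : Seminorm ℝ (Matrix (Fin d) (Fin d) ℝ)) :
    ∃ C : ℝ, 0 < C ∧ ∀ (X : Matrix (Fin d) (Fin d) ℝ) (b : ℝ), 0 ≤ b → (∀ i j, |X i j| ≤ b) →
      ν X ≤ C * b := by
  refine ⟨(∑ i, ∑ j, ν (Matrix.single i j 1)) + 1,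
    add_pos_of_nonneg_of_pos (Finset.sum_nonneg fun _ _ => Finset.sum_nonneg fun _ _ =>
      apply_nonneg _ _) one_pos, fun X b hb hX => ?_⟩
  calc ν X = ν (∑ i, ∑ j, Matrix.single i j (X i j)) := by rw [← Matrix.matrix_eq_sum_single]
    _ ≤ ∑ i, ∑ j, ν (Matrix.single i j (X i j)) :=
        (Finset.le_sum_of_subadditive ν (map_zero ν).le (map_add_le_add ν) _ _).trans
          (Finset.sum_le_sum fun i _ =>
            Finset.le_sum_of_subadditive ν (map_zero ν).le (map_add_le_add ν) _ _)
    _ ≤ ∑ i, ∑ j, ν (Matrix.single i j 1) * b := by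
        refine Finset.sum_le_sum fun i _ => Finset.sum_le_sum fun j _ => ?_
        have : Matrix.single i j (X i j) = X i j • Matrix.single i j (1 : ℝ) := by
          simp [Matrix.smul_single]
        rw [this, map_smul_eq_mul, Real.norm_eq_abs, mul_comm]
        gcongr
        exact hX i j
    _ ≤ _ := by
        simp only [← Finset.sum_mul]
        gcongr
        simp

-- Definiteness gives `ν`, continuous by the preceding bound, a positive minimum on the unit sphere.
attribute [local instance] Matrix.normedAddCommGroup Matrix.normedSpace in
theorem Seminorm.exists_abs_entry_le (ν : Seminorm ℝ (Matrix (Fin d) (Fin d) ℝ))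
    (hν : ∀ X, ν X = 0 → X = 0) :
    ∃ C : ℝ, 0 < C ∧ ∀ (X : Matrix (Fin d) (Fin d) ℝ) i j, |X i j| ≤ C * ν X := by
  obtain ⟨B, hB, hle⟩ := ν.exists_le_of_abs_entry_le
  have hcont : Continuous ν := by
    refine Seminorm.continuous_of_le
      (q := B.toNNReal • normSeminorm ℝ (Matrix (Fin d) (Fin d) ℝ)) ?_ fun X => ?_
    · exact continuous_norm.const_smul B.toNNReal
    · change ν X ≤ B.toNNReal * ‖X‖
      rw [Real.coe_toNNReal _ hB.le]
      exact hle X _ (norm_nonneg _) fun i j => Matrix.norm_entry_le_entrywise_sup_norm X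
  obtain ⟨c, hc, hcν⟩ : ∃ c : ℝ, 0 < c ∧
      ∀ X ∈ Metric.sphere (0 : Matrix (Fin d) (Fin d) ℝ) 1, c ≤ ν X := by
    have : ProperSpace (Matrix (Fin d) (Fin d) ℝ) :=
      inferInstanceAs (ProperSpace (Fin d → Fin d → ℝ))
    rcases (Metric.sphere (0 : Matrix (Fin d) (Fin d) ℝ) 1).eq_empty_or_nonempty with h | h
    · exact ⟨1, one_pos, by simp [h]⟩
    · obtain ⟨Z, hZ, hmin⟩ := (isCompact_sphere 0 1).exists_isMinOn h hcont.continuousOn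
      refine ⟨ν Z, lt_of_le_of_ne (apply_nonneg _ _) fun h0 => ?_, fun w hw => hmin hw⟩
      rw [hν Z h0.symm] at hZ
      simp at hZ
  refine ⟨c⁻¹, by positivity, fun X i j => ?_⟩
  refine (show |X i j| ≤ ‖X‖ from Matrix.norm_entry_le_entrywise_sup_norm X).trans ?_
  rcases eq_or_ne X 0 with rfl | hX
  · simp
  have hX' : 0 < ‖X‖ := norm_pos_iff.2 hX
  have h := hcν (‖X‖⁻¹ • X) (by simp [norm_smul, hX'.ne'])
  rw [map_smul_eq_mul, norm_inv, norm_norm, ← div_eq_inv_mul, le_div_iff₀ hX'] at h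
  rw [← div_eq_inv_mul, le_div_iff₀ hc]
  linarith

end MatrixNorms

theorem ENNReal.tendsto_ofReal_mul_pow_rpow_one_div {C s : ℝ} (hC : 0 < C) (hs : 0 ≤ s) :
    Tendsto (fun k : ℕ => ENNReal.ofReal (C * s ^ k) ^ (1 / (k : ℝ))) atTop
      (𝓝 (ENNReal.ofReal s)) := by
  have h : Tendsto (fun k : ℕ => ENNReal.ofReal (C ^ (1 / (k : ℝ)) * s)) atTop
      (𝓝 (ENNReal.ofReal (C ^ (0 : ℝ) * s))) := by
    refine ENNReal.tendsto_ofReal (Filter.Tendsto.mul_const s ?_)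
    exact tendsto_const_nhds.rpow tendsto_one_div_atTop_nhds_zero_nat (Or.inl hC.ne')
  rw [Real.rpow_zero, one_mul] at h
  refine h.congr' ?_
  filter_upwards [eventually_ne_atTop 0] with k hk
  rw [ENNReal.ofReal_rpow_of_nonneg (by positivity) (by positivity),
    Real.mul_rpow hC.le (by positivity), one_div, Real.pow_rpow_inv_natCast hs hk]

/-! ### Spectral radii -/

section SpectralRadius

variable {n : ℕ}

attribute [local instance] Matrix.linftyOpNormedRing Matrix.linftyOpNormedAlgebra

/-- Gelfand's formula for the maximal row sum; a row has `n` entries, and the resulting constant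
disappears in the `k`-th root. -/
theorem matrixSpectralRadius_le_of_abs_pow_le {M : Matrix (Fin n) (Fin n) ℝ} {C s : ℝ}
    (hC : 0 < C) (hs : 0 ≤ s) (h : ∀ᶠ k : ℕ in atTop, ∀ i j, |(M ^ k) i j| ≤ C * s ^ k) :
    matrixSpectralRadius M ≤ ENNReal.ofReal s := by
  have : CompleteSpace (Matrix (Fin n) (Fin n) ℂ) := FiniteDimensional.complete ℂ _
  have hC' : 0 < n * C + 1 := by positivity
  refine le_of_tendsto_of_tendsto
    (spectrum.pow_nnnorm_pow_one_div_tendsto_nhds_spectralRadius (M.map (algebraMap ℝ ℂ)))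
    (ENNReal.tendsto_ofReal_mul_pow_rpow_one_div hC' hs) ?_
  filter_upwards [h] with k hk
  gcongr
  rw [← ENNReal.ofReal_coe_nnreal, coe_nnnorm]
  refine ENNReal.ofReal_le_ofReal ?_
  have hmap : M.map (algebraMap ℝ ℂ) ^ k = (M ^ k).map (algebraMap ℝ ℂ) :=
    (map_pow (algebraMap ℝ ℂ).mapMatrix M k).symm
  have hB : 0 ≤ (n * C + 1) * s ^ k := by positivity
  rw [hmap, Matrix.linfty_opNorm_def, ← Real.coe_toNNReal _ hB, NNReal.coe_le_coe]
  refine Finset.sup_le fun i _ => ?_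
  rw [← NNReal.coe_le_coe, Real.coe_toNNReal _ hB, NNReal.coe_sum]
  calc ∑ j, ((‖(M ^ k).map (algebraMap ℝ ℂ) i j‖₊ : NNReal) : ℝ)
      ≤ ∑ _j : Fin n, C * s ^ k := Finset.sum_le_sum fun j _ => by simpa using hk i j
    _ = n * C * s ^ k := by simp [mul_assoc]
    _ ≤ _ := by gcongr; linarith

/-- Gelfand's formula in the other direction. The gap `t < s` later makes a geometric series
converge. -/
theorem exists_abs_pow_le_of_matrixSpectralRadius_lt {M : Matrix (Fin n) (Fin n) ℝ} {s : ℝ}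
    (h : matrixSpectralRadius M < ENNReal.ofReal s) :
    ∃ t, 0 < t ∧ t < s ∧ ∀ᶠ k : ℕ in atTop, ∀ i j, |(M ^ k) i j| ≤ t ^ k := by
  have : CompleteSpace (Matrix (Fin n) (Fin n) ℂ) := FiniteDimensional.complete ℂ _
  obtain ⟨t, ht0, ht, hts⟩ := ENNReal.lt_iff_exists_real_btwn.1 h
  have ht' : 0 < t := by
    by_contra! h'
    simp [ENNReal.ofReal_of_nonpos h'] at ht
  refine ⟨t, ht', (ENNReal.ofReal_lt_ofReal_iff_of_nonneg ht0).1 hts, ?_⟩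
  filter_upwards [(spectrum.pow_norm_pow_one_div_tendsto_nhds_spectralRadius
    (M.map (algebraMap ℝ ℂ))).eventually_lt_const ht, eventually_ne_atTop 0] with k hk hk0 i j
  rw [ENNReal.ofReal_lt_ofReal_iff ht', one_div,
    Real.rpow_inv_lt_iff_of_pos (norm_nonneg _) ht'.le (by positivity), Real.rpow_natCast] at hk
  refine le_trans ?_ hk.le
  have hmap : M.map (algebraMap ℝ ℂ) ^ k = (M ^ k).map (algebraMap ℝ ℂ) :=
    (map_pow (algebraMap ℝ ℂ).mapMatrix M k).symm
  rw [hmap, Matrix.linfty_opNorm_def]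
  calc |(M ^ k) i j| = ((‖(M ^ k).map (algebraMap ℝ ℂ) i j‖₊ : NNReal) : ℝ) := by simp
    _ ≤ ((∑ j, ‖(M ^ k).map (algebraMap ℝ ℂ) i j‖₊ : NNReal) : ℝ) :=
        NNReal.coe_le_coe.2 (Finset.single_le_sum
          (f := fun j => ‖(M ^ k).map (algebraMap ℝ ℂ) i j‖₊) (fun _ _ => zero_le)
          (Finset.mem_univ j))
    _ ≤ _ := NNReal.coe_le_coe.2 (Finset.le_sup
          (f := fun i => ∑ j, ‖(M ^ k).map (algebraMap ℝ ℂ) i j‖₊) (Finset.mem_univ i))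

end SpectralRadius

/-! ### Kronecker powers -/

section KroneckerPow

variable {d : ℕ}

/-- The Kronecker power of a vector. -/
def vecKroneckerPow (x : Fin d → ℝ) : (p : ℕ) → Fin (d ^ p) → ℝ
  | 0 => 1
  | p + 1 => fun i =>
      vecKroneckerPow x p (finProdFinEquiv.symm i).1 * x (finProdFinEquiv.symm i).2

theorem kroneckerPow_succ_apply (M : Matrix (Fin d) (Fin d) ℝ) (p : ℕ) (i j : Fin (d ^ (p + 1))) :
    kroneckerPow M (p + 1) i j =
      kroneckerPow M p (finProdFinEquiv.symm i).1 (finProdFinEquiv.symm j).1 *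
        M (finProdFinEquiv.symm i).2 (finProdFinEquiv.symm j).2 :=
  rfl

theorem kroneckerPow_mul (M N : Matrix (Fin d) (Fin d) ℝ) (p : ℕ) :
    kroneckerPow (M * N) p = kroneckerPow M p * kroneckerPow N p := by
  induction p with
  | zero => exact (one_mul _).symm
  | succ p ih =>
    change Matrix.reindexAlgEquiv ℝ ℝ finProdFinEquiv (kroneckerPow (M * N) p ⊗ₖ (M * N)) =
      Matrix.reindexAlgEquiv ℝ ℝ finProdFinEquiv (kroneckerPow M p ⊗ₖ M) *
        Matrix.reindexAlgEquiv ℝ ℝ finProdFinEquiv (kroneckerPow N p ⊗ₖ N)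
    rw [ih, Matrix.mul_kronecker_mul, map_mul]

theorem one_kroneckerPow (p : ℕ) : kroneckerPow (1 : Matrix (Fin d) (Fin d) ℝ) p = 1 := by
  induction p with
  | zero => rfl
  | succ p ih =>
    change Matrix.reindexAlgEquiv ℝ ℝ finProdFinEquiv
      (kroneckerPow (1 : Matrix (Fin d) (Fin d) ℝ) p ⊗ₖ 1) = 1
    rw [ih, Matrix.one_kronecker_one, map_one]

theorem continuous_kroneckerPow_apply (p : ℕ) (i j : Fin (d ^ p)) :
    Continuous fun M : Matrix (Fin d) (Fin d) ℝ => kroneckerPow M p i j := by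
  induction p with
  | zero => exact continuous_const
  | succ p ih =>
    simp only [kroneckerPow_succ_apply]
    exact (ih _ _).mul (continuous_id.matrix_elem _ _)

theorem abs_kroneckerPow_apply_le {M : Matrix (Fin d) (Fin d) ℝ} {b : ℝ} (h : ∀ i j, |M i j| ≤ b)
    (p : ℕ) (i j : Fin (d ^ p)) : |kroneckerPow M p i j| ≤ b ^ p := by
  induction p with
  | zero =>
    change |(1 : Matrix (Fin (d ^ 0)) (Fin (d ^ 0)) ℝ) i j| ≤ b ^ 0
    rw [Matrix.one_apply]
    split_ifs <;> simp
  | succ p ih =>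
    rw [kroneckerPow_succ_apply, abs_mul, pow_succ]
    have hi := ih (finProdFinEquiv.symm i).1 (finProdFinEquiv.symm j).1
    exact mul_le_mul hi (h _ _) (abs_nonneg _) ((abs_nonneg _).trans hi)

theorem vecKroneckerPow_succ_apply (x : Fin d → ℝ) (p : ℕ) (a : Fin (d ^ p)) (b : Fin d) :
    vecKroneckerPow x (p + 1) (finProdFinEquiv (a, b)) = vecKroneckerPow x p a * x b := by
  change vecKroneckerPow x p (finProdFinEquiv.symm (finProdFinEquiv (a, b))).1 *
    x (finProdFinEquiv.symm (finProdFinEquiv (a, b))).2 = _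
  rw [Equiv.symm_apply_apply]

theorem sum_fin_pow_succ (p : ℕ) (f : Fin (d ^ (p + 1)) → ℝ) :
    ∑ i, f i = ∑ a : Fin (d ^ p), ∑ b : Fin d, f (finProdFinEquiv (a, b)) :=
  (finProdFinEquiv.sum_comp (f : Fin (d ^ p * d) → ℝ)).symm.trans (Fintype.sum_prod_type _)

theorem kroneckerPow_mulVec (M : Matrix (Fin d) (Fin d) ℝ) (x : Fin d → ℝ) (p : ℕ) :
    (kroneckerPow M p).mulVec (vecKroneckerPow x p) = vecKroneckerPow (M.mulVec x) p := by
  induction p with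
  | zero => exact Matrix.one_mulVec _
  | succ p ih =>
    ext i
    change ∑ j, kroneckerPow M (p + 1) i j * vecKroneckerPow x (p + 1) j =
      vecKroneckerPow (M.mulVec x) p (finProdFinEquiv.symm i).1 *
        ∑ b, M (finProdFinEquiv.symm i).2 b * x b
    rw [← ih, sum_fin_pow_succ]
    change _ = (∑ a, kroneckerPow M p (finProdFinEquiv.symm i).1 a * vecKroneckerPow x p a) * _
    rw [Finset.sum_mul_sum]
    refine Finset.sum_congr rfl fun a _ => Finset.sum_congr rfl fun b _ => ?_
    rw [vecKroneckerPow_succ_apply]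
    change kroneckerPow M p (finProdFinEquiv.symm i).1
      (finProdFinEquiv.symm (finProdFinEquiv (a, b))).1 * M (finProdFinEquiv.symm i).2
      (finProdFinEquiv.symm (finProdFinEquiv (a, b))).2 * _ = _
    rw [Equiv.symm_apply_apply]
    ring

/-- With `kroneckerPow_mulVec` this makes `(y ⬝ᵥ M.mulVec x) ^ p` linear in `kroneckerPow M p`, so
its expectation can be read off from `expectedKroneckerPow`. -/
theorem vecKroneckerPow_dotProduct (y x : Fin d → ℝ) (p : ℕ) :
    vecKroneckerPow y p ⬝ᵥ vecKroneckerPow x p = (y ⬝ᵥ x) ^ p := by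
  induction p with
  | zero =>
    change ∑ _i : Fin 1, (1 : ℝ) * 1 = _
    simp
  | succ p ih =>
    rw [dotProduct, sum_fin_pow_succ, pow_succ (y ⬝ᵥ x), ← ih, dotProduct, dotProduct,
      Finset.sum_mul_sum]
    refine Finset.sum_congr rfl fun a _ => Finset.sum_congr rfl fun b _ => ?_
    rw [vecKroneckerPow_succ_apply, vecKroneckerPow_succ_apply]
    ring

theorem vecKroneckerPow_smul (t : ℝ) (x : Fin d → ℝ) (p : ℕ) :
    vecKroneckerPow (t • x) p = t ^ p • vecKroneckerPow x p := by
  induction p with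
  | zero => exact (congrArg (· • (1 : Fin (d ^ 0) → ℝ)) (pow_zero t)).trans (one_smul ℝ _) |>.symm
  | succ p ih =>
    ext i
    change vecKroneckerPow (t • x) p (finProdFinEquiv.symm i).1 *
      (t * x (finProdFinEquiv.symm i).2) = t ^ (p + 1) *
        (vecKroneckerPow x p (finProdFinEquiv.symm i).1 * x (finProdFinEquiv.symm i).2)
    rw [ih, Pi.smul_apply, smul_eq_mul]
    ring

theorem continuous_vecKroneckerPow (p : ℕ) :
    Continuous fun x : Fin d → ℝ => vecKroneckerPow x p := by
  induction p with
  | zero => exact continuous_const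
  | succ p ih =>
    exact continuous_pi fun i => ((continuous_apply _).comp ih).mul (continuous_apply _)

end KroneckerPow

/-! ### Expected Kronecker powers -/

section ExpectedKroneckerPow

variable {d : ℕ} {μ : Measure (Matrix (Fin d) (Fin d) ℝ)}

/-- The form `y^{⊗p} · E[A^{⊗p}]^k x^{⊗p}`. -/
noncomputable def momentForm (μ : Measure (Matrix (Fin d) (Fin d) ℝ)) (y : Fin d → ℝ) (p k : ℕ)
    (x : Fin d → ℝ) : ℝ :=
  vecKroneckerPow y p ⬝ᵥ ((expectedKroneckerPow μ p ^ k).mulVec (vecKroneckerPow x p))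

theorem momentForm_zero (y : Fin d → ℝ) (p : ℕ) (x : Fin d → ℝ) :
    momentForm μ y p 0 x = (y ⬝ᵥ x) ^ p := by
  simp [momentForm, vecKroneckerPow_dotProduct]

theorem continuous_momentForm (y : Fin d → ℝ) (p k : ℕ) : Continuous (momentForm μ y p k) :=
  continuous_const.dotProduct (continuous_const.matrix_mulVec (continuous_vecKroneckerPow p))

theorem momentForm_smul (y : Fin d → ℝ) (p k : ℕ) (t : ℝ) (x : Fin d → ℝ) :
    momentForm μ y p k (t • x) = t ^ p * momentForm μ y p k x := by
  simp [momentForm, vecKroneckerPow_smul, Matrix.mulVec_smul]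

theorem ae_mem_support : ∀ᵐ A ∂μ, A ∈ μ.support := by
  have : SecondCountableTopology (Matrix (Fin d) (Fin d) ℝ) :=
    inferInstanceAs (SecondCountableTopology (Fin d → Fin d → ℝ))
  exact Measure.support_mem_ae

variable [IsProbabilityMeasure μ]

theorem integrable_of_isCompact_support (hμ : IsCompact μ.support)
    {f : Matrix (Fin d) (Fin d) ℝ → ℝ} (hf : Continuous f) : Integrable f μ := by
  have : SecondCountableTopology (Matrix (Fin d) (Fin d) ℝ) :=
    inferInstanceAs (SecondCountableTopology (Fin d → Fin d → ℝ))
  obtain ⟨C, hC⟩ := hμ.exists_bound_of_continuousOn hf.continuousOn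
  refine Integrable.of_bound hf.measurable.aestronglyMeasurable C ?_
  filter_upwards [ae_mem_support] with A hA using hC A hA

/-- Linear functionals commute with the expectation of Kronecker powers. -/
theorem map_expectedKroneckerPow (hμ : IsCompact μ.support) {p : ℕ}
    (l : Matrix (Fin (d ^ p)) (Fin (d ^ p)) ℝ →ₗ[ℝ] ℝ) :
    l (expectedKroneckerPow μ p) = ∫ A, l (kroneckerPow A p) ∂μ := by
  have h : ∀ X, l X = ∑ i, ∑ j, X i j * l (Matrix.single i j 1) := fun X => by
    conv_lhs => rw [Matrix.matrix_eq_sum_single X]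
    simp only [map_sum]
    refine Finset.sum_congr rfl fun i _ => Finset.sum_congr rfl fun j _ => ?_
    rw [← smul_eq_mul, ← map_smul, Matrix.smul_single, smul_eq_mul, mul_one]
  have hint : ∀ i j, Integrable
      (fun A => kroneckerPow A p i j * l (Matrix.single i j 1)) μ := fun i j =>
    integrable_of_isCompact_support hμ ((continuous_kroneckerPow_apply p i j).mul continuous_const)
  simp only [h (kroneckerPow _ p)]
  rw [h, integral_finsetSum _ fun i _ => integrable_finsetSum _ fun j _ => hint i j]
  refine Finset.sum_congr rfl fun i _ => ?_
  rw [integral_finsetSum _ fun j _ => hint i j]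
  refine Finset.sum_congr rfl fun j _ => ?_
  rw [integral_mul_const]
  rfl

/-- A bound for a linear functional on the Kronecker powers of all products of length `k` is a bound
for its value at the `k`-th power of the expected Kronecker power. -/
theorem abs_map_expectedKroneckerPow_pow_le (hμ : IsCompact μ.support) {p : ℕ} (k : ℕ) {c : ℝ}
    (l : Matrix (Fin (d ^ p)) (Fin (d ^ p)) ℝ →ₗ[ℝ] ℝ)
    (h : ∀ L : List (Matrix (Fin d) (Fin d) ℝ), L.length = k → (∀ A ∈ L, A ∈ μ.support) →
      |l (kroneckerPow L.prod p)| ≤ c) :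
    |l (expectedKroneckerPow μ p ^ k)| ≤ c := by
  induction k generalizing l with
  | zero => simpa [one_kroneckerPow] using h [] rfl
  | succ k ih =>
    -- One factor at a time is integrated: the remaining power is absorbed into the functional on
    -- the right, then the sampled `A` on the left. No product measure is needed.
    let l' := l ∘ₗ LinearMap.mulRight ℝ (expectedKroneckerPow μ p ^ k)
    have h1 : l (expectedKroneckerPow μ p ^ (k + 1)) = l' (expectedKroneckerPow μ p) := by
      simp [l', pow_succ']
    rw [h1, map_expectedKroneckerPow hμ, ← Real.norm_eq_abs]
    refine (norm_integral_le_of_norm_le_const (C := c) ?_).trans (by simp)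
    filter_upwards [ae_mem_support] with A hA
    refine ih (l ∘ₗ LinearMap.mulLeft ℝ (kroneckerPow A p)) fun L hL hLs => ?_
    simpa [kroneckerPow_mul] using h (A :: L) (by simpa using hL) (by simpa [hA] using hLs)

/-- Integrates out the factor that acts on `x` first; iterated, it identifies the form with `E[(y ·
A_k ⋯ A_1 x)^p]`. -/
theorem momentForm_succ (hμ : IsCompact μ.support) (y : Fin d → ℝ) (p k : ℕ) (x : Fin d → ℝ) :
    momentForm μ y p (k + 1) x = ∫ A, momentForm μ y p k (A.mulVec x) ∂μ := by
  let l : Matrix (Fin (d ^ p)) (Fin (d ^ p)) ℝ →ₗ[ℝ] ℝ :=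
    { toFun := fun X => vecKroneckerPow y p ⬝ᵥ
        ((expectedKroneckerPow μ p ^ k * X).mulVec (vecKroneckerPow x p))
      map_add' := fun X Y => by rw [mul_add, Matrix.add_mulVec, dotProduct_add]
      map_smul' := fun c X => by simp [Matrix.smul_mulVec] }
  have h := map_expectedKroneckerPow hμ l
  simp only [l, LinearMap.coe_mk, AddHom.coe_mk, ← Matrix.mulVec_mulVec, kroneckerPow_mulVec] at h
  rw [momentForm, pow_succ, ← Matrix.mulVec_mulVec, h]
  rfl

variable {K : Set (Fin d → ℝ)}

theorem integrable_momentForm_mulVec (hμ : IsCompact μ.support) (y : Fin d → ℝ) (p k : ℕ)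
    (x : Fin d → ℝ) : Integrable (fun A => momentForm μ y p k (A.mulVec x)) μ :=
  integrable_of_isCompact_support hμ
    ((continuous_momentForm y p k).comp (continuous_id.matrix_mulVec continuous_const))

/-- Here and in the next two lemmas the case `k = 0` is a property of `t ↦ t ^ p` on `t ≥ 0`. It
survives averaging because almost every `A` maps `K` linearly into itself. -/
theorem momentForm_nonneg (hμ : IsCompact μ.support) (hinv : LeavesInvariant μ.support K)
    {y : Fin d → ℝ} (hy : ∀ x ∈ K, 0 ≤ y ⬝ᵥ x) (p k : ℕ) {x : Fin d → ℝ} (hx : x ∈ K) :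
    0 ≤ momentForm μ y p k x := by
  induction k generalizing x with
  | zero => exact momentForm_zero (μ := μ) y p x ▸ pow_nonneg (hy x hx) p
  | succ k ih =>
    rw [momentForm_succ hμ]
    refine integral_nonneg_of_ae ?_
    filter_upwards [ae_mem_support] with A hA using ih (hinv A hA x hx)

theorem momentForm_le_add (hμ : IsCompact μ.support)
    (hinv : LeavesInvariant μ.support K) {y : Fin d → ℝ} (hy : ∀ x ∈ K, 0 ≤ y ⬝ᵥ x) (p k : ℕ)
    {x z : Fin d → ℝ} (hx : x ∈ K) (hz : z ∈ K) :
    momentForm μ y p k x ≤ momentForm μ y p k (x + z) := by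
  induction k generalizing x z with
  | zero =>
    rw [momentForm_zero, momentForm_zero, dotProduct_add]
    exact pow_le_pow_left₀ (hy x hx) (le_add_of_nonneg_right (hy z hz)) p
  | succ k ih =>
    rw [momentForm_succ hμ, momentForm_succ hμ]
    refine integral_mono_ae (integrable_momentForm_mulVec hμ y p k x)
      (integrable_momentForm_mulVec hμ y p k _) ?_
    filter_upwards [ae_mem_support] with A hA
    rw [Matrix.mulVec_add]
    exact ih (hinv A hA x hx) (hinv A hA z hz)

theorem convexOn_momentForm (hK : IsProperCone K) (hμ : IsCompact μ.support)
    (hinv : LeavesInvariant μ.support K) {y : Fin d → ℝ} (hy : ∀ x ∈ K, 0 ≤ y ⬝ᵥ x) (p k : ℕ) :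
    ConvexOn ℝ K (momentForm μ y p k) := by
  refine ⟨hK.convex, ?_⟩
  induction k with
  | zero =>
    intro x hx z hz a b ha hb hab
    simp only [momentForm_zero, dotProduct_add, dotProduct_smul]
    exact (convexOn_pow p).2 (hy x hx) (hy z hz) ha hb hab
  | succ k ih =>
    intro x hx z hz a b ha hb hab
    simp only [momentForm_succ hμ, smul_eq_mul]
    rw [← integral_const_mul, ← integral_const_mul,
      ← integral_add ((integrable_momentForm_mulVec hμ y p k x).const_mul a)
        ((integrable_momentForm_mulVec hμ y p k z).const_mul b)]
    refine integral_mono_ae (integrable_momentForm_mulVec hμ y p k _)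
      (((integrable_momentForm_mulVec hμ y p k x).const_mul a).add
        ((integrable_momentForm_mulVec hμ y p k z).const_mul b)) ?_
    filter_upwards [ae_mem_support] with A hA
    rw [Matrix.mulVec_add, Matrix.mulVec_smul, Matrix.mulVec_smul]
    exact ih (hinv A hA x hx) (hinv A hA z hz) ha hb hab

end ExpectedKroneckerPow

/-! ### The joint spectral radius -/

section JointSpectralRadius

variable {d : ℕ} {ν : Seminorm ℝ (Matrix (Fin d) (Fin d) ℝ)} {S : Set (Matrix (Fin d) (Fin d) ℝ)}

theorem jointSpectralRadius_le_of_le {C r : ℝ} (hC : 0 < C) (hr : 0 ≤ r)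
    (h : ∀ L : List (Matrix (Fin d) (Fin d) ℝ), (∀ A ∈ L, A ∈ S) → ν L.prod ≤ C * r ^ L.length) :
    jointSpectralRadius ν S ≤ ENNReal.ofReal r := by
  rw [← (ENNReal.tendsto_ofReal_mul_pow_rpow_one_div hC hr).limsup_eq]
  refine limsup_le_limsup (Eventually.of_forall fun k => iSup₂_le fun A hA => ?_)
  refine ENNReal.rpow_le_rpow (ENNReal.ofReal_le_ofReal ?_) (by positivity)
  have := h (List.ofFn fun i : Fin k => A i.rev) (by simp [List.mem_ofFn]; exact fun i => hA _)
  simpa using this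

theorem eventually_le_of_jointSpectralRadius_lt {b : ℝ}
    (h : jointSpectralRadius ν S < ENNReal.ofReal b) :
    ∀ᶠ k : ℕ in atTop, ∀ L : List (Matrix (Fin d) (Fin d) ℝ), L.length = k → (∀ A ∈ L, A ∈ S) →
      ν L.prod ≤ b ^ k := by
  have hb : 0 < b := by
    by_contra! h'
    simp [ENNReal.ofReal_of_nonpos h'] at h
  filter_upwards [eventually_lt_of_limsup_lt h, eventually_ne_atTop 0] with k hk hk0 L hL hLS
  subst hL
  -- Reversing the indices cancels the reversal in `jointSpectralRadius`, so the product is `L.prod`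
  -- itself.
  have h1 := (le_iSup₂ (f := fun (A : Fin L.length → Matrix (Fin d) (Fin d) ℝ) (_ : ∀ i, A i ∈ S) =>
      ENNReal.ofReal (ν (List.ofFn fun i : Fin L.length => A i.rev).prod) ^
        (1 / (L.length : ℝ))) (fun i => L.get i.rev) fun i => hLS _ (List.get_mem _ _)).trans hk.le
  simp only [Fin.rev_rev, List.ofFn_get] at h1
  rw [one_div, ENNReal.rpow_inv_le_iff (by positivity), ENNReal.rpow_natCast,
    ← ENNReal.ofReal_pow hb.le, ENNReal.ofReal_le_ofReal_iff (by positivity)] at h1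
  exact h1

theorem jointSpectralRadius_ne_top (hS : IsCompact S) : jointSpectralRadius ν S ≠ ⊤ := by
  have hb : ∃ B : ℝ, 0 ≤ B ∧ ∀ A ∈ S, ∀ i j, |A i j| ≤ B := by
    choose B hB using fun i j => hS.exists_bound_of_continuousOn
      (f := fun A : Matrix (Fin d) (Fin d) ℝ => A i j)
      (continuous_id.matrix_elem i j).continuousOn
    refine ⟨∑ i, ∑ j, |B i j|, by positivity, fun A hA i j => ?_⟩
    calc |A i j| ≤ |B i j| := (hB i j A hA).trans (le_abs_self _)
      _ ≤ ∑ j, |B i j| := Finset.single_le_sum (f := fun j => |B i j|)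
          (fun _ _ => abs_nonneg _) (Finset.mem_univ j)
      _ ≤ _ := Finset.single_le_sum (f := fun i => ∑ j, |B i j|)
          (fun _ _ => by positivity) (Finset.mem_univ i)
  obtain ⟨B, hB0, hB⟩ := hb
  obtain ⟨C, hC, hνC⟩ := ν.exists_le_of_abs_entry_le
  -- Each multiplication sums `d` terms, so a product of `k` matrices with entries at most `B` has
  -- entries at most `(d * B) ^ k`.
  refine ne_top_of_le_ne_top ENNReal.ofReal_ne_top
    (jointSpectralRadius_le_of_le hC (r := d * B) (by positivity) fun L hL => ?_)
  refine hνC _ _ (by positivity) ?_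
  induction L with
  | nil =>
    intro i j
    rw [List.prod_nil, Matrix.one_apply]
    split_ifs <;> simp
  | cons A L ih =>
    intro i j
    rw [List.prod_cons, Matrix.mul_apply, List.length_cons]
    calc |∑ l, A i l * L.prod l j| ≤ ∑ l, |A i l * L.prod l j| := Finset.abs_sum_le_sum_abs _ _
      _ ≤ ∑ _l : Fin d, B * (d * B) ^ L.length := by
          refine Finset.sum_le_sum fun l _ => ?_
          rw [abs_mul]
          exact mul_le_mul (hB A (hL A (by simp)) i l)
            (ih (fun A' hA' => hL A' (by simp [hA'])) l j) (abs_nonneg _) hB0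
      _ = (d * B) ^ (L.length + 1) := by simp [pow_succ]; ring

theorem matrixSpectralRadius_rpow_le_jointSpectralRadius
    {μ : Measure (Matrix (Fin d) (Fin d) ℝ)} [IsProbabilityMeasure μ] (hμ : IsCompact μ.support)
    (hν : ∀ X, ν X = 0 → X = 0) {p : ℕ} (hp : p ≠ 0) :
    matrixSpectralRadius (expectedKroneckerPow μ p) ^ (1 / (p : ℝ)) ≤
      jointSpectralRadius ν μ.support := by
  refine le_of_forall_gt_imp_ge_of_dense fun b hb => ?_
  rcases eq_or_ne b ⊤ with rfl | hbtop
  · exact le_top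
  rw [← ENNReal.ofReal_toReal hbtop] at hb ⊢
  set t := b.toReal with ht
  have ht0 : 0 ≤ t := ENNReal.toReal_nonneg
  obtain ⟨C, hC, hCν⟩ := ν.exists_abs_entry_le hν
  rw [one_div, ENNReal.rpow_inv_le_iff (by positivity), ENNReal.rpow_natCast,
    ← ENNReal.ofReal_pow ht0]
  refine matrixSpectralRadius_le_of_abs_pow_le (C := C ^ p) (by positivity) (by positivity) ?_
  filter_upwards [eventually_le_of_jointSpectralRadius_lt hb] with k hk i j
  refine abs_map_expectedKroneckerPow_pow_le hμ k (Matrix.entryLinearMap ℝ ℝ i j)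
    fun L hL hLS => ?_
  refine (abs_kroneckerPow_apply_le (fun i j => (hCν L.prod i j).trans
    (mul_le_mul_of_nonneg_left (hk L hL hLS) hC.le)) p i j).trans_eq ?_
  rw [mul_pow]
  ring

end JointSpectralRadius

/-! ### Cone norms -/

/-- A nonnegative, positively homogeneous, monotone and subadditive function on the cone `K`. -/
structure IsConeNorm {d : ℕ} (K : Set (Fin d → ℝ)) (v : (Fin d → ℝ) → ℝ) : Prop where
  nonneg : ∀ x ∈ K, 0 ≤ v x
  smul : ∀ t : ℝ, 0 ≤ t → ∀ x ∈ K, v (t • x) = t * v x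
  le_add : ∀ x ∈ K, ∀ z ∈ K, v x ≤ v (x + z)
  add_le : ∀ x ∈ K, ∀ z ∈ K, v (x + z) ≤ v x + v z

section ConeNorm

variable {d : ℕ} {K : Set (Fin d → ℝ)}

/-- The `p`-th root of a convex, monotone, `p`-homogeneous function on a cone is a cone norm. -/
theorem isConeNorm_rpow_one_div (hK : IsProperCone K) {p : ℕ} (hp : p ≠ 0)
    {Φ : (Fin d → ℝ) → ℝ} (hnonneg : ∀ x ∈ K, 0 ≤ Φ x)
    (hsmul : ∀ (t : ℝ), ∀ x ∈ K, Φ (t • x) = t ^ p * Φ x)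
    (hmono : ∀ x ∈ K, ∀ z ∈ K, Φ x ≤ Φ (x + z)) (hconv : ConvexOn ℝ K Φ) :
    IsConeNorm K fun x => Φ x ^ (1 / (p : ℝ)) where
  nonneg x hx := Real.rpow_nonneg (hnonneg x hx) _
  smul t ht x hx := by
    rw [hsmul t x hx, Real.mul_rpow (by positivity) (hnonneg x hx), one_div,
      Real.pow_rpow_inv_natCast ht hp]
  le_add x hx z hz := Real.rpow_le_rpow (hnonneg x hx) (hmono x hx z hz) (by positivity)
  add_le x hx z hz := by
    -- The slack `ε` keeps `a` and `b` below positive, hence invertible, even where `Φ` vanishes.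
    refine le_of_forall_pos_le_add fun ε hε => ?_
    have hroot : ∀ w ∈ K, Φ w ≤ (Φ w ^ (1 / (p : ℝ)) + ε / 2) ^ p := fun w hw => by
      have h0 := Real.rpow_nonneg (hnonneg w hw) (1 / (p : ℝ))
      calc Φ w = (Φ w ^ (1 / (p : ℝ))) ^ p := by
            rw [one_div, Real.rpow_inv_natCast_pow (hnonneg w hw) hp]
        _ ≤ _ := pow_le_pow_left₀ h0 (by linarith) p
    have hvx := Real.rpow_nonneg (hnonneg x hx) (1 / (p : ℝ))
    have hvz := Real.rpow_nonneg (hnonneg z hz) (1 / (p : ℝ))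
    have hx' := hroot x hx
    have hz' := hroot z hz
    set a := Φ x ^ (1 / (p : ℝ)) + ε / 2 with ha
    set b := Φ z ^ (1 / (p : ℝ)) + ε / 2 with hb
    have ha0 : 0 < a := by positivity
    have hb0 : 0 < b := by positivity
    -- Gauge argument: `Φ ≤ 1` at `a⁻¹ • x` and `b⁻¹ • z`, hence at their convex combination, and `x
    -- + z` is `a + b` times a suitable one.
    have hone : ∀ w ∈ K, ∀ c : ℝ, 0 < c → Φ w ≤ c ^ p → Φ (c⁻¹ • w) ≤ 1 := fun w hw c hc h => by
      rw [hsmul _ w hw, inv_pow, ← div_eq_inv_mul]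
      exact div_le_one_of_le₀ h (by positivity)
    have hle := hconv.2 (hK.smul_mem a⁻¹ (by positivity) x hx)
      (hK.smul_mem b⁻¹ (by positivity) z hz)
      (show 0 ≤ a / (a + b) by positivity) (show 0 ≤ b / (a + b) by positivity)
      (by rw [← add_div, div_self (by positivity)])
    have hle1 : Φ ((a / (a + b)) • a⁻¹ • x + (b / (a + b)) • b⁻¹ • z) ≤ 1 := by
      refine hle.trans ?_
      calc _ ≤ a / (a + b) * 1 + b / (a + b) * 1 := by
            simp only [smul_eq_mul]
            gcongr
            · exact hone x hx a ha0 hx'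
            · exact hone z hz b hb0 hz'
        _ = 1 := by field_simp
    have heq : x + z = (a + b) • ((a / (a + b)) • a⁻¹ • x + (b / (a + b)) • b⁻¹ • z) := by
      rw [smul_add, smul_smul, smul_smul, smul_smul, smul_smul]
      congr 1
      · rw [show (a + b) * (a / (a + b)) * a⁻¹ = 1 by field_simp, one_smul]
      · rw [show (a + b) * (b / (a + b)) * b⁻¹ = 1 by field_simp, one_smul]
    have hmem : (a / (a + b)) • a⁻¹ • x + (b / (a + b)) • b⁻¹ • z ∈ K :=
      hK.add_mem (hK.smul_mem _ (by positivity) _ (hK.smul_mem _ (by positivity) _ hx))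
        (hK.smul_mem _ (by positivity) _ (hK.smul_mem _ (by positivity) _ hz))
    have hfin : Φ (x + z) ≤ (a + b) ^ p := by
      rw [heq, hsmul _ _ hmem]
      exact mul_le_of_le_one_right (by positivity) hle1
    calc Φ (x + z) ^ (1 / (p : ℝ)) ≤ ((a + b) ^ p) ^ (1 / (p : ℝ)) :=
          Real.rpow_le_rpow (hnonneg _ (hK.add_mem hx hz)) hfin (by positivity)
      _ = a + b := by rw [one_div, Real.pow_rpow_inv_natCast (by positivity) hp]
      _ = _ := by rw [ha, hb]; ring

variable {μ : Measure (Matrix (Fin d) (Fin d) ℝ)}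

theorem summable_momentForm (y : Fin d → ℝ) {p : ℕ} {q : ℝ}
    (hρ : matrixSpectralRadius (expectedKroneckerPow μ p) < ENNReal.ofReal q) (x : Fin d → ℝ) :
    Summable fun k => q⁻¹ ^ k * momentForm μ y p k x := by
  obtain ⟨t, ht, htq, hev⟩ := exists_abs_pow_le_of_matrixSpectralRadius_lt hρ
  have hq : 0 < q := ht.trans htq
  set D := ∑ i, ∑ j, |vecKroneckerPow y p i| * |vecKroneckerPow x p j|
  refine Summable.of_norm_bounded_eventually_nat (g := fun k => D * (q⁻¹ * t) ^ k)
    ((summable_geometric_of_lt_one (by positivity)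
      (by rw [← div_eq_inv_mul]; exact (div_lt_one hq).2 htq)).mul_left D) ?_
  filter_upwards [hev] with k hk
  have : |momentForm μ y p k x| ≤ D * t ^ k := by
    simp only [momentForm, dotProduct, Matrix.mulVec, D, Finset.sum_mul, Finset.mul_sum]
    refine (Finset.abs_sum_le_sum_abs _ _).trans (Finset.sum_le_sum fun i _ =>
      (Finset.abs_sum_le_sum_abs _ _).trans (Finset.sum_le_sum fun j _ => ?_))
    rw [abs_mul, abs_mul]
    calc _ ≤ |vecKroneckerPow y p i| * (t ^ k * |vecKroneckerPow x p j|) := by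
          gcongr
          exact hk i j
      _ = _ := by ring
  rw [norm_mul, norm_pow, norm_inv, Real.norm_of_nonneg hq.le, Real.norm_eq_abs]
  calc q⁻¹ ^ k * |momentForm μ y p k x| ≤ q⁻¹ ^ k * (D * t ^ k) := by gcongr
    _ = _ := by rw [mul_pow]; ring

variable [IsProbabilityMeasure μ]

/-- If the `p`-th root of the spectral radius of `E[A^{⊗p}]` is less than `r`, then there is a cone
norm, bounded below by a given functional, which on average is not expanded by more than `r` in the
sense of `p`-th moments. -/
theorem exists_isConeNorm (hK : IsProperCone K) (hμ : IsCompact μ.support)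
    (hinv : LeavesInvariant μ.support K) {y : Fin d → ℝ} (hy : ∀ x ∈ K, 0 ≤ y ⬝ᵥ x) {p : ℕ}
    (hp : p ≠ 0) {r : ℝ} (hr : 0 < r)
    (hρ : matrixSpectralRadius (expectedKroneckerPow μ p) < ENNReal.ofReal (r ^ p)) :
    ∃ v, IsConeNorm K v ∧ (∀ x ∈ K, y ⬝ᵥ x ≤ v x) ∧
      ∀ m : ℝ, 0 < m → ∀ s, ENNReal.ofReal m ≤ μ s → ∀ x ∈ K,
        ∃ A ∈ s, A ∈ μ.support ∧ v (A.mulVec x) ≤ r * m⁻¹ ^ (1 / (p : ℝ)) * v x := by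
  set q := r ^ p with hq
  have hq0 : 0 < q := by positivity
  have hsum := fun x => summable_momentForm y hρ x
  set Φ : (Fin d → ℝ) → ℝ := fun x => ∑' k, q⁻¹ ^ k * momentForm μ y p k x with hΦ
  have hterm : ∀ x ∈ K, ∀ k, 0 ≤ q⁻¹ ^ k * momentForm μ y p k x := fun x hx k =>
    mul_nonneg (by positivity) (momentForm_nonneg hμ hinv hy p k hx)
  have hΦ0 : ∀ x ∈ K, 0 ≤ Φ x := fun x hx => tsum_nonneg (hterm x hx)
  have hΦy : ∀ x ∈ K, (y ⬝ᵥ x) ^ p ≤ Φ x := fun x hx => by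
    have := (hsum x).le_tsum 0 fun k _ => hterm x hx k
    rwa [pow_zero, one_mul, momentForm_zero] at this
  -- The shifted series is `q` times the series of `Φ` without its nonnegative term `k = 0`.
  have hshift : ∀ x ∈ K, ∑' k, q⁻¹ ^ k * momentForm μ y p (k + 1) x ≤ q * Φ x := fun x hx => by
    have h1 := (hsum x).tsum_eq_zero_add
    have h2 : ∑' k, q⁻¹ ^ k * momentForm μ y p (k + 1) x =
        q * ∑' k, q⁻¹ ^ (k + 1) * momentForm μ y p (k + 1) x := by
      rw [← tsum_mul_left]
      refine tsum_congr fun k => ?_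
      rw [pow_succ]
      field_simp
    rw [h2]
    gcongr
    simp only [hΦ]
    rw [h1]
    exact le_add_of_nonneg_left (hterm x hx 0)
  have hmeas : ∀ x k, Measurable fun A : Matrix (Fin d) (Fin d) ℝ =>
      ENNReal.ofReal (q⁻¹ ^ k * momentForm μ y p k (A.mulVec x)) := fun x k =>
    (((continuous_momentForm y p k).comp
      (continuous_id.matrix_mulVec continuous_const)).const_mul _).measurable.ennreal_ofReal
  -- Working in `ℝ≥0∞` lets sum and integral be exchanged with measurability alone; this is `E[Φ(A
  -- x)] ≤ q * Φ(x)`.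
  have hlint : ∀ x ∈ K, ∫⁻ A, ∑' k, ENNReal.ofReal (q⁻¹ ^ k * momentForm μ y p k (A.mulVec x)) ∂μ
      ≤ ENNReal.ofReal (q * Φ x) := fun x hx => by
    rw [lintegral_tsum fun k => ?_]
    · have h1 : ∀ k, ∫⁻ A, ENNReal.ofReal (q⁻¹ ^ k * momentForm μ y p k (A.mulVec x)) ∂μ =
          ENNReal.ofReal (q⁻¹ ^ k * momentForm μ y p (k + 1) x) := fun k => by
        rw [momentForm_succ hμ, ← integral_const_mul, ofReal_integral_eq_lintegral_ofReal
          ((integrable_momentForm_mulVec hμ y p k x).const_mul _)]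
        filter_upwards [ae_mem_support] with A hA using hterm _ (hinv A hA x hx) k
      have hs : Summable fun k => q⁻¹ ^ k * momentForm μ y p (k + 1) x := by
        refine (((summable_nat_add_iff 1).2 (hsum x)).mul_left q).congr fun k => ?_
        rw [pow_succ]
        field_simp
      rw [tsum_congr h1, ← ENNReal.ofReal_tsum_of_nonneg (fun k => mul_nonneg (by positivity)
        (momentForm_nonneg hμ hinv hy p _ hx)) hs]
      exact ENNReal.ofReal_le_ofReal (hshift x hx)
    · exact (hmeas x k).aemeasurable
  refine ⟨fun x => Φ x ^ (1 / (p : ℝ)), isConeNorm_rpow_one_div hK hp hΦ0 ?_ ?_ ?_, ?_, ?_⟩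
  · intro t x _
    simp only [hΦ, momentForm_smul]
    rw [← tsum_mul_left]
    exact tsum_congr fun k => by ring
  · intro x hx z hz
    exact (hsum x).tsum_le_tsum (fun k => mul_le_mul_of_nonneg_left
      (momentForm_le_add hμ hinv hy p k hx hz) (by positivity)) (hsum _)
  · refine ⟨hK.convex, fun x hx z hz a b ha hb hab => ?_⟩
    simp only [hΦ, smul_eq_mul]
    rw [← tsum_mul_left, ← tsum_mul_left, ← ((hsum x).mul_left a).tsum_add ((hsum z).mul_left b)]
    refine (hsum _).tsum_le_tsum (fun k => ?_) (((hsum x).mul_left a).add ((hsum z).mul_left b))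
    have := (convexOn_momentForm hK hμ hinv hy p k).2 hx hz ha hb hab
    calc _ ≤ q⁻¹ ^ k * (a • momentForm μ y p k x + b • momentForm μ y p k z) := by gcongr
      _ = _ := by simp only [smul_eq_mul]; ring
  · intro x hx
    calc y ⬝ᵥ x = ((y ⬝ᵥ x) ^ p) ^ (1 / (p : ℝ)) := by
          rw [one_div, Real.pow_rpow_inv_natCast (hy x hx) hp]
      _ ≤ _ := Real.rpow_le_rpow (pow_nonneg (hy x hx) p) (hΦy x hx) (by positivity)
  · intro m hm s hs x hx
    have hs' : ENNReal.ofReal m ≤ μ (s ∩ μ.support) := by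
      rwa [measure_inter_conull' (by
        rw [← nonpos_iff_eq_zero]
        exact (measure_mono (Set.sdiff_subset_compl _ _)).trans (le_of_eq ae_mem_support))]
    have hpos : μ (s ∩ μ.support) ≠ 0 := (lt_of_lt_of_le (ENNReal.ofReal_pos.2 hm) hs').ne'
    have htsum : Measurable fun A : Matrix (Fin d) (Fin d) ℝ =>
        ∑' k, ENNReal.ofReal (q⁻¹ ^ k * momentForm μ y p k (A.mulVec x)) :=
      Measurable.tsum (hmeas x)
    -- Some point of the set lies below the average over it, which is at most `q * Φ x / m`. The
    -- choice depends on `x`.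
    obtain ⟨A, ⟨hAs, hA⟩, hle⟩ := exists_le_setLAverage hpos (measure_ne_top _ _)
      htsum.aemeasurable
    refine ⟨A, hAs, hA, ?_⟩
    have hAx := hinv A hA x hx
    have hmain : Φ (A.mulVec x) ≤ q * Φ x / m := by
      rw [← ENNReal.ofReal_le_ofReal_iff (div_nonneg (mul_nonneg hq0.le (hΦ0 x hx)) hm.le),
        ENNReal.ofReal_div_of_pos hm, ENNReal.ofReal_tsum_of_nonneg (hterm _ hAx) (hsum _)]
      refine hle.trans ?_
      rw [setLAverage_eq]
      exact ENNReal.div_le_div ((setLIntegral_le_lintegral _ _).trans (hlint x hx)) hs'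
    calc Φ (A.mulVec x) ^ (1 / (p : ℝ)) ≤ (q * Φ x / m) ^ (1 / (p : ℝ)) :=
          Real.rpow_le_rpow (hΦ0 _ hAx) hmain (by positivity)
      _ = (q * m⁻¹ * Φ x) ^ (1 / (p : ℝ)) := by congr 1; field_simp
      _ = _ := by
        rw [Real.mul_rpow (by positivity) (hΦ0 x hx), Real.mul_rpow hq0.le (by positivity), hq]
        congr 2
        rw [one_div, Real.pow_rpow_inv_natCast hr.le hp]

end ConeNorm

/-! ### The joint spectral radius in terms of moments -/

section Moments

variable {d : ℕ} {K : Set (Fin d → ℝ)}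

theorem jointSpectralRadius_le_of_isConeNorm {ν : Seminorm ℝ (Matrix (Fin d) (Fin d) ℝ)}
    {S : Set (Matrix (Fin d) (Fin d) ℝ)} (hK : IsProperCone K) (hinv : LeavesInvariant S K)
    {v : (Fin d → ℝ) → ℝ} (hv : IsConeNorm K v) (hnorm : ∀ x ∈ K, ‖x‖ ≤ v x) {r : ℝ} (hr : 0 ≤ r)
    (h : ∀ A ∈ S, ∀ x ∈ K, v (A.mulVec x) ≤ r * v x) :
    jointSpectralRadius ν S ≤ ENNReal.ofReal r := by
  have hprod : ∀ L : List (Matrix (Fin d) (Fin d) ℝ), (∀ A ∈ L, A ∈ S) → ∀ x ∈ K,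
      L.prod.mulVec x ∈ K ∧ v (L.prod.mulVec x) ≤ r ^ L.length * v x := by
    intro L hL x hx
    induction L with
    | nil => simpa using hx
    | cons A L ih =>
      obtain ⟨h1, h2⟩ := ih fun A' hA' => hL A' (by simp [hA'])
      have hA := hL A (by simp)
      rw [List.prod_cons, ← Matrix.mulVec_mulVec, List.length_cons, pow_succ']
      refine ⟨hinv A hA _ h1, (h A hA _ h1).trans ?_⟩
      rw [mul_assoc]
      gcongr
  obtain ⟨e, he, C, hC, hunit⟩ := hK.exists_order_unit
  obtain ⟨B, hB, hνB⟩ := ν.exists_le_of_abs_entry_le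
  -- Each basis vector is a difference `w j - u j` of cone elements, so bounds on `K` control every
  -- column of a product.
  set u : Fin d → Fin d → ℝ := fun j => (C * ‖(Pi.single j 1 : Fin d → ℝ)‖) • e with hu
  set w : Fin d → Fin d → ℝ := fun j => u j + Pi.single j 1 with hw
  have huK : ∀ j, u j ∈ K := fun j => hK.smul_mem _ (by positivity) _ he
  have hwK : ∀ j, w j ∈ K := fun j => hunit _
  have hv0 : ∀ j, 0 ≤ v (w j) + v (u j) := fun j =>
    add_nonneg (hv.nonneg _ (hwK j)) (hv.nonneg _ (huK j))
  have hD : 0 ≤ ∑ j, (v (w j) + v (u j)) := Finset.sum_nonneg fun j _ => hv0 j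
  refine jointSpectralRadius_le_of_le (C := B * (∑ j, (v (w j) + v (u j)) + 1)) (by positivity) hr
    fun L hL => ?_
  rw [mul_assoc]
  refine hνB _ _ (by positivity) fun i j => ?_
  have hcol : L.prod i j = (L.prod.mulVec (w j) - L.prod.mulVec (u j)) i := by
    rw [← Matrix.mulVec_sub, hw, add_sub_cancel_left, Matrix.mulVec_single_one]
    rfl
  obtain ⟨hw1, hw2⟩ := hprod L hL _ (hwK j)
  obtain ⟨hu1, hu2⟩ := hprod L hL _ (huK j)
  calc |L.prod i j| ≤ ‖L.prod.mulVec (w j) - L.prod.mulVec (u j)‖ := by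
        rw [hcol, ← Real.norm_eq_abs]
        exact norm_le_pi_norm _ i
    _ ≤ ‖L.prod.mulVec (w j)‖ + ‖L.prod.mulVec (u j)‖ := norm_sub_le _ _
    _ ≤ r ^ L.length * v (w j) + r ^ L.length * v (u j) :=
        add_le_add ((hnorm _ hw1).trans hw2) ((hnorm _ hu1).trans hu2)
    _ = (v (w j) + v (u j)) * r ^ L.length := by ring
    _ ≤ _ := by
        refine mul_le_mul_of_nonneg_right (le_add_of_le_of_nonneg ?_ zero_le_one) (by positivity)
        exact Finset.single_le_sum (f := fun j => v (w j) + v (u j)) (fun j _ => hv0 j)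
          (Finset.mem_univ j)

theorem tendsto_mul_inv_rpow_one_div {m : ℝ} (hm : 0 < m) (r : ℝ) :
    Tendsto (fun p : ℕ => r * m⁻¹ ^ (1 / (p : ℝ))) atTop (𝓝 r) := by
  have h : Tendsto (fun p : ℕ => m⁻¹ ^ (1 / (p : ℝ))) atTop (𝓝 (m⁻¹ ^ (0 : ℝ))) :=
    tendsto_const_nhds.rpow tendsto_one_div_atTop_nhds_zero_nat (Or.inl (inv_pos.2 hm).ne')
  simpa using h.const_mul r

variable {ν : Seminorm ℝ (Matrix (Fin d) (Fin d) ℝ)} {μ : Measure (Matrix (Fin d) (Fin d) ℝ)}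

/-- Balls of a given radius centred at the points of a compact support have measure bounded
below. -/
theorem exists_le_measure_entrywise_ball (hμ : IsCompact μ.support) {δ : ℝ} (hδ : 0 < δ) :
    ∃ m : ℝ, 0 < m ∧ ∀ A₀ ∈ μ.support, ENNReal.ofReal m ≤ μ {A | ∀ i j, |A₀ i j - A i j| < δ} := by
  refine hμ.induction_on
    (p := fun s => ∃ m : ℝ, 0 < m ∧
      ∀ A₀ ∈ s, ENNReal.ofReal m ≤ μ {A | ∀ i j, |A₀ i j - A i j| < δ}) ⟨1, by simp⟩ ?_ ?_ ?_
  · rintro s t hst ⟨m, hm, h⟩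
    exact ⟨m, hm, fun A hA => h A (hst hA)⟩
  · rintro s t ⟨m, hm, h⟩ ⟨m', hm', h'⟩
    refine ⟨min m m', lt_min hm hm', ?_⟩
    rintro A (hA | hA)
    · exact (ENNReal.ofReal_le_ofReal (min_le_left _ _)).trans (h A hA)
    · exact (ENNReal.ofReal_le_ofReal (min_le_right _ _)).trans (h' A hA)
  · intro X hX
    -- With radius `δ / 2`, the `δ`-ball around any point of `U` contains all of `U`.
    set U := {A : Matrix (Fin d) (Fin d) ℝ | ∀ i j, |X i j - A i j| < δ / 2} with hU
    have hUo : IsOpen U := by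
      simp only [hU, Set.ofPred_forall]
      exact isOpen_iInter_of_finite fun i => isOpen_iInter_of_finite fun j =>
        isOpen_lt (continuous_const.sub (continuous_id.matrix_elem i j)).abs continuous_const
    have hUX : U ∈ 𝓝 X := hUo.mem_nhds fun i j => by simpa using hδ
    have hpos : 0 < μ U := Measure.mem_support_iff_forall X |>.1 hX U hUX
    obtain ⟨m, hm0, hm, hmU⟩ := ENNReal.lt_iff_exists_real_btwn.1 hpos
    refine ⟨U, mem_nhdsWithin_of_mem_nhds hUX, m, ENNReal.ofReal_pos.1 hm, fun A₀ hA₀ => ?_⟩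
    refine hmU.le.trans (measure_mono fun A hA i j => ?_)
    have h1 := hA₀ i j
    have h2 := hA i j
    rw [abs_lt] at *
    constructor <;> linarith [h1.1, h1.2, h2.1, h2.2]

/-- Near an interior point of the matrices preserving `K`, all matrices map the cone uniformly into
its interior. -/
theorem eventually_mulVec_sub_smul_mem {A₁ : Matrix (Fin d) (Fin d) ℝ}
    (hA₁ : A₁ ∈ interior {A : Matrix (Fin d) (Fin d) ℝ | ∀ x ∈ K, A.mulVec x ∈ K})
    (e y : Fin d → ℝ) :
    ∃ c : ℝ, 0 < c ∧ ∀ᶠ A in 𝓝 A₁, ∀ x ∈ K, A.mulVec x - (c * (y ⬝ᵥ x)) • e ∈ K := by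
  -- Subtracting a small multiple of the rank-one matrix `e yᵀ` from a matrix near `A₁` still leaves
  -- one that preserves `K`.
  have hcont : Continuous fun q : Matrix (Fin d) (Fin d) ℝ × ℝ =>
      q.1 - q.2 • Matrix.vecMulVec e y :=
    continuous_fst.sub (continuous_snd.smul continuous_const)
  have hev : ∀ᶠ q in 𝓝 (A₁, (0 : ℝ)), q.1 - q.2 • Matrix.vecMulVec e y ∈
      {A : Matrix (Fin d) (Fin d) ℝ | ∀ x ∈ K, A.mulVec x ∈ K} :=
    hcont.continuousAt.eventually_mem (by simpa using mem_interior_iff_mem_nhds.1 hA₁)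
  rw [nhds_prod_eq] at hev
  obtain ⟨pa, ha, pb, hb, hab⟩ := eventually_prod_iff.1 hev
  obtain ⟨c, hc, hc0⟩ := ((hb.filter_mono nhdsWithin_le_nhds).and
    (self_mem_nhdsWithin : Set.Ioi (0 : ℝ) ∈ 𝓝[>] 0)).exists
  refine ⟨c, hc0, ha.mono fun A hA x hx => ?_⟩
  have h := hab hA hc x hx
  rw [Matrix.sub_mulVec, Matrix.smul_mulVec] at h
  convert h using 2
  ext i
  simp only [Pi.smul_apply, smul_eq_mul, Matrix.mulVec, dotProduct, Matrix.vecMulVec_apply,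
    Finset.mul_sum, Finset.sum_mul]
  exact Finset.sum_congr rfl fun j _ => by ring

variable [IsProbabilityMeasure μ]

/-- Applied to a singleton, `exists_isConeNorm` can only return its single matrix, so the bound
holds for every matrix of the support. -/
theorem jointSpectralRadius_le_of_atomic (hK : IsProperCone K) (hμ : IsCompact μ.support)
    (hinv : LeavesInvariant μ.support K) {m : ℝ} (hm : 0 < m)
    (hatom : ∀ A ∈ μ.support, ENNReal.ofReal m ≤ μ {A}) {r r' : ℝ} (hr : 0 < r) (hrr' : r < r')
    (hfreq : ∃ᶠ p in atTop,
      matrixSpectralRadius (expectedKroneckerPow μ p) < ENNReal.ofReal (r ^ p)) :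
    jointSpectralRadius ν μ.support ≤ ENNReal.ofReal r' := by
  obtain ⟨y, hy⟩ := hK.exists_norm_le_dotProduct
  obtain ⟨p, hρ, hpm, hp⟩ := (hfreq.and_eventually
    (((tendsto_mul_inv_rpow_one_div hm r).eventually_lt_const hrr').and
      (eventually_ne_atTop 0))).exists
  obtain ⟨v, hv, hyv, hmean⟩ :=
    exists_isConeNorm hK hμ hinv (fun x hx => (norm_nonneg x).trans (hy x hx)) hp hr hρ
  refine jointSpectralRadius_le_of_isConeNorm hK hinv hv (fun x hx => (hy x hx).trans (hyv x hx))
    (hr.trans hrr').le fun A hA x hx => ?_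
  obtain ⟨A', hA', -, hle⟩ := hmean m hm {A} (hatom A hA) x hx
  rw [Set.mem_singleton_iff.1 hA'] at hle
  exact hle.trans (mul_le_mul_of_nonneg_right hpm.le (hv.nonneg x hx))

theorem jointSpectralRadius_le_of_mem_interior (hK : IsProperCone K) (hμ : IsCompact μ.support)
    (hinv : LeavesInvariant μ.support K) {A₁ : Matrix (Fin d) (Fin d) ℝ} (hA₁ : A₁ ∈ μ.support)
    (hint : A₁ ∈ interior {A : Matrix (Fin d) (Fin d) ℝ | ∀ x ∈ K, A.mulVec x ∈ K})
    {r r' : ℝ} (hr : 0 < r) (hrr' : r < r')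
    (hfreq : ∃ᶠ p in atTop,
      matrixSpectralRadius (expectedKroneckerPow μ p) < ENNReal.ofReal (r ^ p)) :
    jointSpectralRadius ν μ.support ≤ ENNReal.ofReal r' := by
  have hr' : 0 < r' := hr.trans hrr'
  obtain ⟨y, hy⟩ := hK.exists_norm_le_dotProduct
  obtain ⟨e, he, C, hC, hunit⟩ := hK.exists_order_unit
  obtain ⟨c, hc, hev⟩ := eventually_mulVec_sub_smul_mem hint e y
  obtain ⟨m₁, -, hm₁, hm₁U⟩ := ENNReal.lt_iff_exists_real_btwn.1
    ((Measure.mem_support_iff_forall A₁).1 hA₁ _ hev)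
  rw [ENNReal.ofReal_pos] at hm₁
  -- Chosen so that `C * (d + 1) * δ = c * (r' - r) / (2 * r')`; `d + 1` avoids division by zero.
  -- All these constants are fixed before `p`, on which `v` depends.
  set δ := c * (r' - r) / (2 * (C * (d + 1)) * r') with hδ
  have hsub : 0 < r' - r := sub_pos.2 hrr'
  have hδ0 : 0 < δ := by positivity
  obtain ⟨m, hm, hball⟩ := exists_le_measure_entrywise_ball hμ hδ0
  obtain ⟨p, hρ, hpm₁, hpm, hp⟩ := (hfreq.and_eventually
    (((tendsto_mul_inv_rpow_one_div hm₁ r).eventually_lt_const hrr').and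
      (((tendsto_mul_inv_rpow_one_div hm r).eventually_lt_const
        (show r < (r + r') / 2 by linarith)).and (eventually_ne_atTop 0)))).exists
  obtain ⟨v, hv, hyv, hmean⟩ :=
    exists_isConeNorm hK hμ hinv (fun x hx => (norm_nonneg x).trans (hy x hx)) hp hr hρ
  refine jointSpectralRadius_le_of_isConeNorm hK hinv hv (fun x hx => (hy x hx).trans (hyv x hx))
    hr'.le fun A₀ hA₀ x hx => ?_
  have hvx := hv.nonneg x hx
  have hve := hv.nonneg e he
  have hyx : 0 ≤ y ⬝ᵥ x := (norm_nonneg x).trans (hy x hx)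
  -- For `A` near `A₁`, `A x` dominates `c * (y ⬝ᵥ x)` times `e` in the cone order, and one such `A`
  -- barely expands `v`.
  have hlow : c * (y ⬝ᵥ x) * v e ≤ r' * v x := by
    obtain ⟨A, hA, -, hle⟩ := hmean m₁ hm₁ _ hm₁U.le x hx
    have h1 := hv.le_add _ (hK.smul_mem (c * (y ⬝ᵥ x)) (by positivity) e he) _ (hA x hx)
    rw [add_sub_cancel, hv.smul _ (by positivity) e he] at h1
    exact (h1.trans hle).trans (mul_le_mul_of_nonneg_right hpm₁.le hvx)
  obtain ⟨A, hA, hAs, hle⟩ := hmean m hm _ (hball A₀ hA₀) x hx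
  have hz : ‖A.mulVec x - A₀.mulVec x‖ ≤ d * δ * (y ⬝ᵥ x) := by
    rw [← Matrix.sub_mulVec]
    refine (pi_norm_le_iff_of_nonneg (by positivity)).2 fun i => ?_
    calc ‖((A - A₀).mulVec x) i‖ ≤ ∑ j, ‖(A - A₀) i j * x j‖ := by
          rw [Matrix.mulVec, dotProduct]
          exact norm_sum_le _ _
      _ ≤ ∑ _j : Fin d, δ * (y ⬝ᵥ x) := by
          refine Finset.sum_le_sum fun j _ => ?_
          rw [norm_mul]
          refine mul_le_mul ?_ ((norm_le_pi_norm x j).trans (hy x hx)) (norm_nonneg _) hδ0.le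
          rw [Matrix.sub_apply, norm_sub_rev]
          exact (hA i j).le
      _ = _ := by simp [mul_assoc]
  set z := A.mulVec x - A₀.mulVec x with hzdef
  have hAx := hinv A hAs x hx
  have hCe : (C * ‖z‖) • e ∈ K := hK.smul_mem _ (by positivity) e he
  -- In the cone order `A₀ x` is at most `A x + C * ‖z‖ * e`.
  have hfirst : v (A₀.mulVec x) ≤ v (A.mulVec x) + C * ‖z‖ * v e := by
    have h1 := hv.le_add _ (hinv A₀ hA₀ x hx) _ (hunit z)
    have h2 := hv.add_le _ hAx _ hCe
    rw [hv.smul _ (by positivity) e he] at h2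
    rw [show A₀.mulVec x + ((C * ‖z‖) • e + z) = A.mulVec x + (C * ‖z‖) • e by
      rw [hzdef]; abel] at h1
    exact h1.trans h2
  have hsecond : C * ‖z‖ * v e ≤ (r' - r) / 2 * v x := by
    calc C * ‖z‖ * v e ≤ C * ((d + 1) * δ * (y ⬝ᵥ x)) * v e := by
          gcongr
          refine hz.trans ?_
          gcongr
          linarith
      _ = (r' - r) / (2 * r') * (c * (y ⬝ᵥ x) * v e) := by
          rw [hδ]
          field_simp
      _ ≤ (r' - r) / (2 * r') * (r' * v x) := by gcongr
      _ = _ := by field_simp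
  have hthird := hle.trans (mul_le_mul_of_nonneg_right hpm.le hvx)
  calc v (A₀.mulVec x) ≤ (r + r') / 2 * v x + (r' - r) / 2 * v x := by linarith
    _ = r' * v x := by ring

/-- If the support consists of matrices on the boundary of the set of matrices preserving `K`, then
the measure is singular, hence atomic. -/
theorem exists_le_measure_singleton (hK : IsProperCone K)
    (hinv : LeavesInvariant μ.support K) (hsing : SingularPartIsFinitelyAtomic μ)
    (hint : ∀ A ∈ μ.support,
      A ∉ interior {A : Matrix (Fin d) (Fin d) ℝ | ∀ x ∈ K, A.mulVec x ∈ K}) :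
    ∃ m : ℝ, 0 < m ∧ ∀ A ∈ μ.support, ENNReal.ofReal m ≤ μ {A} := by
  set P := {A : Matrix (Fin d) (Fin d) ℝ | ∀ x ∈ K, A.mulVec x ∈ K} with hP
  have hPconv : Convex ℝ P := fun A hA B hB a b ha hb hab x hx => by
    rw [Matrix.add_mulVec, Matrix.smul_mulVec, Matrix.smul_mulVec]
    exact hK.convex (hA x hx) (hB x hx) ha hb hab
  have hnull : matrixLebesgue d (frontier P) = 0 :=
    Convex.addHaar_frontier (E := Fin d → Fin d → ℝ) volume hPconv
  have hsupp : μ.support ⊆ frontier P := fun A hA =>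
    ⟨subset_closure fun x hx => hinv A hA x hx, hint A hA⟩
  have : SigmaFinite (matrixLebesgue d) :=
    inferInstanceAs (SigmaFinite (volume : Measure (Fin d → Fin d → ℝ)))
  have hdecomp := μ.singularPart_add_rnDeriv (matrixLebesgue d)
  -- The absolutely continuous part charges neither the support, which is Lebesgue-null, nor its
  -- complement, which is `μ`-null.
  have hac : (matrixLebesgue d).withDensity (μ.rnDeriv (matrixLebesgue d)) = 0 := by
    rw [← Measure.measure_univ_eq_zero, ← Set.union_compl_self μ.support]
    refine measure_union_null (withDensity_absolutelyContinuous _ _ (measure_mono_null hsupp hnull))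
      (le_antisymm ?_ zero_le)
    exact (Measure.withDensity_rnDeriv_le μ _ _).trans_eq ae_mem_support
  rw [hac, add_zero] at hdecomp
  obtain ⟨N, w, M, hw, hμs⟩ := hsing
  rw [hdecomp] at hμs
  have happly : ∀ s, MeasurableSet s →
      μ s = ∑ i, ENNReal.ofReal (w i) * s.indicator 1 (M i) := fun s hs => by
    rw [hμs, Measure.finsetSum_apply]
    simp [Measure.dirac_apply' _ hs]
  have : T1Space (Matrix (Fin d) (Fin d) ℝ) := inferInstanceAs (T1Space (Fin d → Fin d → ℝ))
  have hmem : ∀ A ∈ μ.support, ∃ i, M i = A := fun A hA => by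
    by_contra! hne
    have hopen : IsOpen (Set.range M)ᶜ := (Set.finite_range M).isClosed.isOpen_compl
    have hpos := (Measure.mem_support_iff_forall A).1 hA _
      (hopen.mem_nhds (by rintro ⟨i, hi⟩; exact hne i hi))
    rw [happly _ hopen.measurableSet] at hpos
    simp at hpos
  obtain ⟨m, hm, hmw⟩ : ∃ m : ℝ, 0 < m ∧ ∀ i, m ≤ w i := by
    rcases isEmpty_or_nonempty (Fin N) with h | h
    · exact ⟨1, one_pos, fun i => h.elim i⟩
    · obtain ⟨i, hi⟩ := Finite.exists_min w
      exact ⟨w i, hw i, hi⟩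
  refine ⟨m, hm, fun A hA => ?_⟩
  obtain ⟨i, rfl⟩ := hmem A hA
  rw [happly _ (isClosed_singleton.measurableSet)]
  refine (ENNReal.ofReal_le_ofReal (hmw i)).trans (le_trans ?_ (Finset.single_le_sum
    (f := fun j => ENNReal.ofReal (w j) * ({M i} : Set _).indicator 1 (M j))
    (fun _ _ => zero_le) (Finset.mem_univ i)))
  simp

end Moments

theorem mainTheorem5 (d : ℕ) (μ : Measure (Matrix (Fin d) (Fin d) ℝ)) [IsProbabilityMeasure μ]
    (hcompact : IsCompact μ.support)
    (hcone : ∃ K : Set (Fin d → ℝ), IsProperCone K ∧ LeavesInvariant μ.support K)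
    (hsing : SingularPartIsFinitelyAtomic μ)
    (ν : Seminorm ℝ (Matrix (Fin d) (Fin d) ℝ)) (hν : ∀ X, ν X = 0 → X = 0) :
    jointSpectralRadius ν μ.support ≠ ⊤ ∧
      Tendsto (fun p : ℕ => matrixSpectralRadius (expectedKroneckerPow μ p) ^ (1 / (p : ℝ))) atTop
        (𝓝 (jointSpectralRadius ν μ.support)) := by
  refine ⟨jointSpectralRadius_ne_top hcompact, tendsto_order.2 ⟨fun a ha => ?_, fun b hb => ?_⟩⟩
  · obtain ⟨K, hK, hinv⟩ := hcone
    by_contra hnot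
    -- The gap between `r` and `r'` absorbs the factor `m^{-1/p}`; infinitely many `p` suffice, as
    -- only one large `p` is used.
    obtain ⟨r', -, har', hr'⟩ := ENNReal.lt_iff_exists_real_btwn.1 ha
    obtain ⟨r, hr0, har, hrr'⟩ := ENNReal.lt_iff_exists_real_btwn.1 har'
    have hr : 0 < r := ENNReal.ofReal_pos.1 (zero_le.trans_lt har)
    rw [ENNReal.ofReal_lt_ofReal_iff_of_nonneg hr0] at hrr'
    have hfreq : ∃ᶠ p in atTop,
        matrixSpectralRadius (expectedKroneckerPow μ p) < ENNReal.ofReal (r ^ p) := by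
      refine ((not_eventually.1 hnot).and_eventually (eventually_ne_atTop 0)).mono ?_
      rintro p ⟨hp, hp0⟩
      have h := (not_lt.1 hp).trans_lt har
      rwa [one_div, ENNReal.rpow_inv_lt_iff (by positivity), ENNReal.rpow_natCast,
        ← ENNReal.ofReal_pow hr0] at h
    refine hr'.not_ge ?_
    by_cases hint : ∃ A ∈ μ.support,
        A ∈ interior {A : Matrix (Fin d) (Fin d) ℝ | ∀ x ∈ K, A.mulVec x ∈ K}
    · obtain ⟨A₁, hA₁, hA₁int⟩ := hint
      exact jointSpectralRadius_le_of_mem_interior hK hcompact hinv hA₁ hA₁int hr hrr' hfreq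
    · push Not at hint
      obtain ⟨m, hm, hatom⟩ := exists_le_measure_singleton hK hinv hsing hint
      exact jointSpectralRadius_le_of_atomic hK hcompact hinv hm hatom hr hrr' hfreq
  · filter_upwards [eventually_ne_atTop 0] with p hp
    exact (matrixSpectralRadius_rpow_le_jointSpectralRadius hcompact hν hp).trans_lt hb
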